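/- Let $\mathbb T^d=\mathbb R^d/\mathbb Z^d$ with normalised Lebesgue measure $dx$. A function $f:\mathbb T^d\to\mathbb R$ has mean zero if $\int_{\mathbb T^d} f\,dx=0$, and $\|f\|_q^q=\int_{\mathbb T^d}|f|^q\,dx$. Let $\hat f(n)=\int_{\mathbb T^d} f(x)e^{-2\pi i n\cdot x}\,dx$ for $n\in\mathbb Z^d$. For $0<\alpha<2$ and $f\in C^2(\mathbb T^d)$, $|\nabla|^\alpha f$ denotes the (a.e. unique) real-valued integrable function on $\mathbb T^d$ with Fourier coefficients $\widehat{|\nabla|^\alpha f}(n)=(2\pi|n|)^\alpha\hat f(n)$, $n\in\mathbb Z^d$, where $|n|$ is the Euclidean length; such a function exists (this is part of the claim). The expression $|f|^{q-2}f$ is read as $0$ where $f=0$. (i) For every integer $d\ge 1$ and every $0<\alpha<2$ there is a constant $c_1>0$, depending only on $\alpha$ and $d$, such that for every real-valued $f\in C^2(\mathbb T^d)$ with mean zero and every $1<q<\infty$, $$\int_{\mathbb T^d}(|\nabla|^\alpha f)\,|f|^{q-2}f\,dx\ \ge\ c_1\,\|f\|_q^q .$$ (ii) There is an absolute constant $c_2>0$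 (in particular independent of $d$, $q$ and $f$) such that for every integer $d\ge1$, every real-valued $f\in C^2(\mathbb T^d)$ with mean zero and every $1<q<\infty$, $$-\int_{\mathbb T^d}(\Delta f)\,|f|^{q-2}f\,dx\ \ge\ c_2\,\frac{q-1}{q^2}\,\|f\|_q^q ,$$ where $\Delta f=\sum_{j=1}^d\partial_j^2 f$ is the classical Laplacian. -/

import Mathlib

open MeasureTheory Real

noncomputable section

/-- The normalised Haar (Lebesgue) measure `dx` on the torus `𝕋^d = ℝ^d / ℤ^d`. It is the measure
used by `UnitAddTorus.mFourierCoeff`. -/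
abbrev torusMeasure (d : ℕ) : Measure (UnitAddTorus (Fin d)) :=
  Measure.pi fun _ => AddCircle.haarAddCircle

/-- It is also the default volume, i.e. the product of the quotient Lebesgue measures. -/
theorem torusMeasure_eq_volume (d : ℕ) :
    torusMeasure d = (volume : Measure (UnitAddTorus (Fin d))) := by
  have h : (AddCircle.haarAddCircle : Measure UnitAddCircle) = volume := by
    rw [AddCircle.volume_eq_smul_haarAddCircle]
    simp
  rw [torusMeasure, h]
  rfl

/-- The quotient map `ℝ^d → 𝕋^d = ℝ^d / ℤ^d`. -/
def toTorus {d : ℕ} (x : EuclideanSpace ℝ (Fin d)) : UnitAddTorus (Fin d) :=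
  fun i => (x i : UnitAddCircle)

/-- `f ∈ C²(𝕋^d)`: the `ℤ^d`-periodic function on `ℝ^d` given by `f` is `C²`. -/
def IsC2Torus {d : ℕ} (f : UnitAddTorus (Fin d) → ℝ) : Prop :=
  ContDiff ℝ 2 fun x : EuclideanSpace ℝ (Fin d) => f (toTorus x)

/-- `f` has mean zero: `∫_{𝕋^d} f(x) dx = 0`. -/
def HasMeanZero {d : ℕ} (f : UnitAddTorus (Fin d) → ℝ) : Prop :=
  ∫ x, f x ∂(torusMeasure d) = 0

/-- The classical Laplacian of `f : 𝕋^d → ℝ` at `x`: the Laplacian of `y ↦ f (x + y)`, as a function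
of `y ∈ ℝ^d`, at `y = 0`. -/
def torusLaplacian {d : ℕ} (f : UnitAddTorus (Fin d) → ℝ) (x : UnitAddTorus (Fin d)) : ℝ :=
  Laplacian.laplacian (fun y : EuclideanSpace ℝ (Fin d) => f (x + toTorus y)) 0

/-- `g = |∇|^α f` on `𝕋^d`: `g` is the (a.e. unique) integrable function with Fourier coefficients
`ĝ(n) = (2π|n|)^α f̂(n)`, `n ∈ ℤ^d`, where `|n|` is the Euclidean length of `n`. -/
def IsFracLaplacian {d : ℕ} (α : ℝ) (f g : UnitAddTorus (Fin d) → ℝ) : Prop :=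
  Integrable g (torusMeasure d) ∧
    ∀ n : Fin d → ℤ,
      UnitAddTorus.mFourierCoeff (fun x => (g x : ℂ)) n =
        (((2 * π * √(∑ i, (n i : ℝ) ^ 2)) ^ α : ℝ) : ℂ) *
          UnitAddTorus.mFourierCoeff (fun x => (f x : ℂ)) n

end

/-! Write ψ = |f|^(q-2) f, and let D_t f(x) = 2f(x) - f(x+t) - f(x-t). Translation invariance gives
∫ D_t f · ψ = ∫ (f(x) - f(x+t)) (ψ(x) - ψ(x+t)) dx (`integral_secondDiff_mul`), which is nonnegative
because ψ is an increasing function of f. Both operators are built from D_t.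

Part (i): |∇|^α f is a positive multiple of ∫ D_y f |y|^(-d-α) dy over ℝ^d
(`IsC2Torus.isFracLaplacian`). After pairing with ψ, keep only y in the unit cube, where the kernel
is at least √d^(-d-α). Averaging over the cube makes x and x+t independent, so mean zero gives
exactly 2‖f‖_q^q (`integral_integral_secondDiff_mul`); no constant depending on q enters.

Part (ii): with u the signed power of f of exponent q/2, the Stroock–Varopoulos inequality bounds ∫
D_t f · ψ below by 4(q-1)/q² · ∫ (u(x) - u(x+t))² dx. Dividing by h² along the coordinate directions
and letting h → 0 controls the nonzero Fourier modes of u, with spectral gap 4π². The function u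
need not have mean zero, but a converse pointwise inequality gives (∫ u)² ≤ ½ ∫ u²
(`sq_integral_signedPow_le`), so the nonzero modes carry at least half of ∫ u² = ‖f‖_q^q. -/

/-! ### Signed powers and pointwise inequalities. -/

/-- The odd extension of `t ↦ t ^ r` to the real line. -/
noncomputable def signedPow (r t : ℝ) : ℝ := |t| ^ (r - 1) * t

theorem signedPow_of_nonneg {r t : ℝ} (hr : r ≠ 0) (ht : 0 ≤ t) : signedPow r t = t ^ r := by
  rcases ht.eq_or_lt with rfl | h
  · simp [signedPow, Real.zero_rpow hr]
  · rw [signedPow, abs_of_pos h, Real.rpow_sub_one h.ne', div_mul_cancel₀ _ h.ne']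

theorem signedPow_neg (r t : ℝ) : signedPow r (-t) = -signedPow r t := by
  simp [signedPow]

theorem abs_signedPow {r : ℝ} (hr : r ≠ 0) (t : ℝ) : |signedPow r t| = |t| ^ r := by
  rcases le_total 0 t with h | h
  · rw [signedPow_of_nonneg hr h, abs_of_nonneg (by positivity), abs_of_nonneg h]
  · rw [← neg_neg t, signedPow_neg, abs_neg, abs_neg, signedPow_of_nonneg hr (by linarith),
      abs_of_nonneg (by apply Real.rpow_nonneg; linarith), abs_of_nonneg (by linarith)]

theorem continuous_signedPow {r : ℝ} (hr : 0 < r) : Continuous (signedPow r) := by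
  rw [continuous_iff_continuousAt]
  intro t
  rcases eq_or_ne t 0 with rfl | h
  · have h0 : signedPow r 0 = 0 := by simp [signedPow]
    rw [ContinuousAt, h0, tendsto_zero_iff_abs_tendsto_zero]
    have h1 : Filter.Tendsto (fun t : ℝ => |t| ^ r) (nhds 0) (nhds (|(0:ℝ)| ^ r)) :=
      (continuous_abs.rpow_const fun _ => Or.inr hr.le).tendsto 0
    rw [abs_zero, Real.zero_rpow hr.ne'] at h1
    refine h1.congr fun t => ?_
    simp [Function.comp, abs_signedPow hr.ne']
  · unfold signedPow
    exact (continuousAt_id.abs.rpow_const (Or.inl (abs_ne_zero.2 h))).mul continuousAt_id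

theorem mul_signedPow {r : ℝ} (hr : r + 1 ≠ 0) (t : ℝ) : t * signedPow r t = |t| ^ (r + 1) := by
  rcases eq_or_ne t 0 with rfl | h
  · simp [Real.zero_rpow hr]
  · have h1 : (0:ℝ) < |t| := abs_pos.2 h
    rw [signedPow, show r + 1 = (r - 1) + 1 + 1 by ring, Real.rpow_add_one h1.ne',
      Real.rpow_add_one h1.ne', mul_assoc, abs_mul_abs_self]
    ring

theorem signedPow_sq {r : ℝ} (hr : r ≠ 0) (t : ℝ) : signedPow r t ^ 2 = |t| ^ (2 * r) := by
  rw [← sq_abs, abs_signedPow hr, mul_comm, Real.rpow_mul (abs_nonneg t), Real.rpow_two]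

/-- The Stroock–Varopoulos inequality for nonnegative numbers. -/
theorem rpow_stroockVaropoulos {q a b : ℝ} (hq : 1 < q) (hb : 0 ≤ b) (hab : b ≤ a) :
    4 * (q - 1) / q ^ 2 * (a ^ (q / 2) - b ^ (q / 2)) ^ 2
      ≤ (a - b) * (a ^ (q - 1) - b ^ (q - 1)) := by
  set s := √(q - 1) with hs
  have hs2 : s ^ 2 = q - 1 := Real.sq_sqrt (by linarith)
  -- Cauchy–Schwarz by discriminant: the quadratic in `l` is the integral of (s t^(q/2-1) - l)² over
  -- [b, a], with monotonicity of the antiderivative replacing the integral.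
  have key : ∀ l : ℝ, 0 ≤ (a - b) * (l * l) + (-(4 * s / q) * (a ^ (q / 2) - b ^ (q / 2))) * l
      + (a ^ (q - 1) - b ^ (q - 1)) := by
    intro l
    have hm : MonotoneOn (fun t : ℝ => t ^ (q - 1) + l * l * t - 4 * s / q * l * t ^ (q / 2))
        (Set.Ici 0) := by
      apply monotoneOn_of_hasDerivWithinAt_nonneg (convex_Ici 0)
        (f' := fun t => (q - 1) * t ^ (q - 1 - 1) + l * l * 1
          - 4 * s / q * l * (q / 2 * t ^ (q / 2 - 1)))
      · refine ContinuousOn.sub (ContinuousOn.add ?_ (by fun_prop)) (ContinuousOn.mul (by fun_prop) ?_)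
        · exact (continuous_id.rpow_const fun _ => Or.inr (by linarith)).continuousOn
        · exact (continuous_id.rpow_const fun _ => Or.inr (by linarith)).continuousOn
      · intro t ht
        rw [interior_Ici, Set.mem_Ioi] at ht
        apply HasDerivAt.hasDerivWithinAt
        exact ((Real.hasDerivAt_rpow_const (Or.inl ht.ne')).add
          ((hasDerivAt_id t).const_mul _)).sub
          ((Real.hasDerivAt_rpow_const (Or.inl ht.ne')).const_mul _)
      · intro t ht
        rw [interior_Ici, Set.mem_Ioi] at ht
        have e : t ^ (q - 1 - 1) = (t ^ (q / 2 - 1)) ^ 2 := by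
          rw [← Real.rpow_natCast, ← Real.rpow_mul ht.le]
          congr 1; push_cast; ring
        have : (q - 1) * t ^ (q - 1 - 1) + l * l * 1 - 4 * s / q * l * (q / 2 * t ^ (q / 2 - 1))
            = (s * t ^ (q / 2 - 1) - l) ^ 2 := by
          rw [e, ← hs2]
          field_simp
          ring
        rw [this]
        positivity
    have := hm hb (hb.trans hab : (0:ℝ) ≤ a) hab
    simp only at this
    linarith
  have := discrim_le_zero key
  rw [discrim] at this
  have e : 4 * (q - 1) / q ^ 2 = (2 * s / q) ^ 2 := by rw [div_pow, mul_pow, hs2]; ring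
  rw [e]
  have : 4 * ((2 * s / q) ^ 2 * (a ^ (q / 2) - b ^ (q / 2)) ^ 2)
      ≤ 4 * ((a - b) * (a ^ (q - 1) - b ^ (q - 1))) := by
    calc _ = (-(4 * s / q) * (a ^ (q / 2) - b ^ (q / 2))) ^ 2 := by ring
      _ ≤ _ := by linarith
  linarith

theorem rpow_half_mul_self {q a : ℝ} (hq : 1 < q) (ha : 0 ≤ a) :
    a ^ (q / 2) * a ^ (q / 2) = a * a ^ (q - 1) := by
  rw [← Real.rpow_add_of_nonneg ha (by linarith) (by linarith)]
  nth_rewrite 2 [← Real.rpow_one a]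
  rw [← Real.rpow_add_of_nonneg ha (by linarith) (by linarith)]
  congr 1; ring

/-- AM–GM: the two terms on the right have product (a^(q/2) b^(q/2))². -/
theorem two_mul_rpow_half_le {q a b : ℝ} (hq : 1 < q) (ha : 0 ≤ a) (hb : 0 ≤ b) :
    2 * (a ^ (q / 2) * b ^ (q / 2)) ≤ a * b ^ (q - 1) + b * a ^ (q - 1) := by
  have h1 := rpow_half_mul_self hq ha
  have h2 := rpow_half_mul_self hq hb
  have h3 : 0 ≤ a ^ (q - 1) := by positivity
  have h4 : 0 ≤ b ^ (q - 1) := by positivity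
  apply abs_le_of_sq_le_sq' _ (by positivity) |>.2
  have : (2 * (a ^ (q / 2) * b ^ (q / 2))) ^ 2
      = 4 * ((a * b ^ (q - 1)) * (b * a ^ (q - 1))) := by
    calc _ = 4 * ((a ^ (q / 2) * a ^ (q / 2)) * (b ^ (q / 2) * b ^ (q / 2))) := by ring
      _ = _ := by rw [h1, h2]; ring
  rw [this]
  nlinarith [sq_nonneg (a * b ^ (q - 1) - b * a ^ (q - 1))]

/-- Reduction of a symmetric, odd inequality between two reals to ordered pairs. -/
theorem real_pair_induction {P : ℝ → ℝ → Prop} (hsymm : ∀ a b, P a b → P b a)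
    (hneg : ∀ a b, P a b → P (-a) (-b)) (hpos : ∀ a b, 0 ≤ b → b ≤ a → P a b)
    (hopp : ∀ a b, 0 ≤ a → 0 ≤ b → P a (-b)) (a b : ℝ) : P a b := by
  have h1 : ∀ a b, 0 ≤ a → 0 ≤ b → P a b := fun a b ha hb =>
    (le_total b a).elim (hpos a b hb) fun h => hsymm _ _ (hpos b a ha h)
  rcases le_total 0 a with ha | ha <;> rcases le_total 0 b with hb | hb
  · exact h1 a b ha hb
  · simpa using hopp a (-b) ha (by linarith)
  · exact hsymm _ _ (by simpa using hopp b (-a) hb (by linarith))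
  · simpa using hneg _ _ (h1 (-a) (-b) (by linarith) (by linarith))

/-- The Stroock–Varopoulos inequality. -/
theorem signedPow_stroockVaropoulos {q : ℝ} (hq : 1 < q) (a b : ℝ) :
    4 * (q - 1) / q ^ 2 * (signedPow (q / 2) a - signedPow (q / 2) b) ^ 2
      ≤ (a - b) * (signedPow (q - 1) a - signedPow (q - 1) b) := by
  have n1 : q / 2 ≠ 0 := by linarith
  have n2 : q - 1 ≠ 0 := by linarith
  induction a, b using real_pair_induction with
  | hsymm a b h => nlinarith
  | hneg a b h => simp only [signedPow_neg]; nlinarith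
  | hpos a b hb hab =>
    have ha := hb.trans hab
    simp only [signedPow_of_nonneg n1, signedPow_of_nonneg n2, ha, hb]
    exact rpow_stroockVaropoulos hq hb hab
  | hopp a b ha hb =>
    simp only [signedPow_neg, signedPow_of_nonneg n1, signedPow_of_nonneg n2, ha, hb]
    have h1 := rpow_half_mul_self hq ha
    have h2 := rpow_half_mul_self hq hb
    have h3 := two_mul_rpow_half_le hq ha hb
    -- For opposite signs the inequality already holds with constant 1, by `two_mul_rpow_half_le`.
    have h4 : 4 * (q - 1) / q ^ 2 ≤ 1 := by
      rw [div_le_one (by positivity)]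
      nlinarith [sq_nonneg (q - 2)]
    calc _ ≤ 1 * (a ^ (q / 2) - -b ^ (q / 2)) ^ 2 := by gcongr
      _ ≤ _ := by nlinarith

theorem sub_mul_signedPow_sub_nonneg {q : ℝ} (hq : 1 < q) (a b : ℝ) :
    0 ≤ (a - b) * (signedPow (q - 1) a - signedPow (q - 1) b) := by
  refine le_trans ?_ (signedPow_stroockVaropoulos hq a b)
  have : 0 < q - 1 := by linarith
  positivity

/-- A converse of the Stroock–Varopoulos inequality, with a constant independent of the
exponent. -/
theorem sub_mul_signedPow_sub_le {q : ℝ} (hq : 1 < q) (a b : ℝ) :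
    (a - b) * (signedPow (q - 1) a - signedPow (q - 1) b)
      ≤ 2 * (signedPow (q / 2) a - signedPow (q / 2) b) ^ 2 := by
  have n1 : q / 2 ≠ 0 := by linarith
  have n2 : q - 1 ≠ 0 := by linarith
  induction a, b using real_pair_induction with
  | hsymm a b h => nlinarith
  | hneg a b h => simp only [signedPow_neg]; nlinarith
  | hpos a b hb hab =>
    have ha := hb.trans hab
    simp only [signedPow_of_nonneg n1, signedPow_of_nonneg n2, ha, hb]
    have h1 := rpow_half_mul_self hq ha
    have h2 := rpow_half_mul_self hq hb
    have h3 := two_mul_rpow_half_le hq ha hb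
    nlinarith [sq_nonneg (a ^ (q / 2) - b ^ (q / 2))]
  | hopp a b ha hb =>
    simp only [signedPow_neg, signedPow_of_nonneg n1, signedPow_of_nonneg n2, ha, hb]
    have h1 := rpow_half_mul_self hq ha
    have h2 := rpow_half_mul_self hq hb
    have h3 : 0 ≤ a ^ (q / 2) * b ^ (q / 2) := by positivity
    -- Rearrangement bounds the cross terms by a^q + b^q. The factor 2 is needed only in this
    -- opposite-sign case.
    have h4 : 0 ≤ (a - b) * (a ^ (q - 1) - b ^ (q - 1)) := by
      rcases le_total a b with h | h
      · exact mul_nonneg_of_nonpos_of_nonpos (by linarith)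
          (sub_nonpos.2 (Real.rpow_le_rpow ha h (by linarith)))
      · exact mul_nonneg (by linarith)
          (sub_nonneg.2 (Real.rpow_le_rpow hb h (by linarith)))
    nlinarith

/-! ### Second differences of C² functions. -/

section SecondDifference

variable {E : Type*} [NormedAddCommGroup E] [NormedSpace ℝ E]

theorem ContDiff.hasDerivAt_symm_sum {F : E → ℝ} (hF : ContDiff ℝ 2 F) (x e : E) (s : ℝ) :
    HasDerivAt (fun s : ℝ => F (x + s • e) + F (x - s • e))
      (fderiv ℝ F (x + s • e) e - fderiv ℝ F (x - s • e) e) s := by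
  have hd : Differentiable ℝ F := hF.differentiable (by norm_num)
  have hl : HasDerivAt (fun s : ℝ => s • e) e s := by
    simpa using (hasDerivAt_id s).smul_const e
  have h1 := (hd (x + s • e)).hasFDerivAt.comp_hasDerivAt s (hl.const_add x)
  have h2 := (hd (x - s • e)).hasFDerivAt.comp_hasDerivAt s (hl.const_sub x)
  exact (h1.add h2).congr_deriv (by simp [sub_eq_add_neg])

theorem ContDiff.differentiable_fderiv_two {F : E → ℝ} (hF : ContDiff ℝ 2 F) :
    Differentiable ℝ (fderiv ℝ F) :=
  (hF.fderiv_right (m := 1) (by norm_num)).differentiable (by norm_num)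

/-- One use of L'Hôpital leaves a symmetric difference quotient of the first derivative, whose limit
comes from differentiability of `fderiv ℝ F` at `x`. -/
theorem ContDiff.tendsto_second_difference {F : E → ℝ} (hF : ContDiff ℝ 2 F) (x e : E) :
    Filter.Tendsto (fun h : ℝ => (F (x + h • e) + F (x - h • e) - 2 * F x) / h ^ 2)
      (nhdsWithin 0 {0}ᶜ) (nhds (fderiv ℝ (fderiv ℝ F) x e e)) := by
  have hd2 := hF.differentiable_fderiv_two
  have hl : ∀ s, HasDerivAt (fun s : ℝ => s • e) e s := fun s => by
    simpa using (hasDerivAt_id s).smul_const e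
  have hder : HasDerivAt (fun s : ℝ => fderiv ℝ F (x + s • e) e - fderiv ℝ F (x - s • e) e)
      (2 * fderiv ℝ (fderiv ℝ F) x e e) 0 := by
    have h1 : HasDerivAt (fun s : ℝ => fderiv ℝ F (x + s • e))
        (fderiv ℝ (fderiv ℝ F) (x + (0:ℝ) • e) e) 0 :=
      (hd2 (x + (0:ℝ) • e)).hasFDerivAt.comp_hasDerivAt 0 ((hl 0).const_add x)
    have h2 : HasDerivAt (fun s : ℝ => fderiv ℝ F (x - s • e))
        (fderiv ℝ (fderiv ℝ F) (x - (0:ℝ) • e) (-e)) 0 :=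
      (hd2 (x - (0:ℝ) • e)).hasFDerivAt.comp_hasDerivAt 0 ((hl 0).const_sub x)
    have h3 := (h1.clm_apply (hasDerivAt_const (0:ℝ) e)).sub
      (h2.clm_apply (hasDerivAt_const (0:ℝ) e))
    refine h3.congr_deriv ?_
    simp only [zero_smul, add_zero, sub_zero, map_neg, map_zero, neg_apply]
    ring
  have hslope := hasDerivAt_iff_tendsto_slope_zero.1 hder
  apply HasDerivAt.lhopital_zero_nhdsNE
    (f' := fun s => fderiv ℝ F (x + s • e) e - fderiv ℝ F (x - s • e) e) (g' := fun s => 2 * s)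
  · exact Filter.Eventually.of_forall fun s => (hF.hasDerivAt_symm_sum x e s).sub_const _
  · exact Filter.Eventually.of_forall fun s => by simpa using hasDerivAt_pow 2 s
  · filter_upwards [self_mem_nhdsWithin] with s hs
    simpa using hs
  · have := ((hF.hasDerivAt_symm_sum x e 0).sub_const (2 * F x)).continuousAt.tendsto
    simp only [zero_smul, add_zero, sub_zero] at this
    rw [show F x + F x - 2 * F x = 0 by ring] at this
    exact this.mono_left nhdsWithin_le_nhds
  · have : Filter.Tendsto (fun s : ℝ => s ^ 2) (nhds 0) (nhds (0 ^ 2)) := (continuous_pow 2).tendsto 0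
    simp only [ne_eq, OfNat.ofNat_ne_zero, not_false_eq_true, zero_pow] at this
    exact this.mono_left nhdsWithin_le_nhds
  · have := hslope.const_mul (1 / 2)
    rw [show (1:ℝ) / 2 * (2 * fderiv ℝ (fderiv ℝ F) x e e) = fderiv ℝ (fderiv ℝ F) x e e by ring]
      at this
    refine this.congr fun s => ?_
    simp
    ring

/-- Two mean value inequalities; the factor 2 comes from the distance 2s‖y‖ between x + sy and x -
sy. -/
theorem ContDiff.abs_second_difference_le {F : E → ℝ} (hF : ContDiff ℝ 2 F) {M : ℝ}
    (hM : ∀ x, ‖fderiv ℝ (fderiv ℝ F) x‖ ≤ M) (x y : E) :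
    |F (x + y) + F (x - y) - 2 * F x| ≤ 2 * M * ‖y‖ ^ 2 := by
  have hd2 := hF.differentiable_fderiv_two
  have hM0 : 0 ≤ M := (norm_nonneg (fderiv ℝ (fderiv ℝ F) 0)).trans (hM 0)
  have hb : ∀ s ∈ Set.Icc (0:ℝ) 1,
      ‖fderiv ℝ F (x + s • y) y - fderiv ℝ F (x - s • y) y‖ ≤ 2 * M * ‖y‖ ^ 2 := by
    intro s hs
    have h1 : ‖fderiv ℝ F (x + s • y) - fderiv ℝ F (x - s • y)‖
        ≤ M * ‖(x + s • y) - (x - s • y)‖ :=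
      convex_univ.norm_image_sub_le_of_norm_fderiv_le (fun z _ => hd2 z) (fun z _ => hM z)
        (Set.mem_univ _) (Set.mem_univ _)
    have h2 : ‖(x + s • y) - (x - s • y)‖ ≤ 2 * ‖y‖ := by
      rw [show (x + s • y) - (x - s • y) = (2 * s) • y by module, norm_smul, Real.norm_eq_abs,
        abs_of_nonneg (by linarith [hs.1])]
      gcongr
      linarith [hs.2]
    calc _ = ‖(fderiv ℝ F (x + s • y) - fderiv ℝ F (x - s • y)) y‖ := rfl
      _ ≤ ‖fderiv ℝ F (x + s • y) - fderiv ℝ F (x - s • y)‖ * ‖y‖ :=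
        ContinuousLinearMap.le_opNorm _ _
      _ ≤ (M * (2 * ‖y‖)) * ‖y‖ := by gcongr; exact h1.trans (by gcongr)
      _ = _ := by ring
  have := (convex_Icc (0:ℝ) 1).norm_image_sub_le_of_norm_hasDerivWithin_le
    (fun s _ => (hF.hasDerivAt_symm_sum x y s).hasDerivWithinAt) hb
    (Set.left_mem_Icc.2 zero_le_one) (Set.right_mem_Icc.2 zero_le_one)
  simp only [one_smul, zero_smul, add_zero, sub_zero, norm_one, mul_one, Real.norm_eq_abs] at this
  rwa [two_mul (F x)]

end SecondDifference

/-! ### The quotient map and periodic C² functions. -/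

section Torus

variable {d : ℕ}

theorem toTorus_add (x y : EuclideanSpace ℝ (Fin d)) :
    toTorus (x + y) = toTorus x + toTorus y := by
  ext i; simp [toTorus]

theorem toTorus_neg (x : EuclideanSpace ℝ (Fin d)) : toTorus (-x) = -toTorus x := by
  ext i; simp [toTorus]

theorem toTorus_sub (x y : EuclideanSpace ℝ (Fin d)) :
    toTorus (x - y) = toTorus x - toTorus y := by
  ext i; simp [toTorus]

theorem toTorus_zero : toTorus (0 : EuclideanSpace ℝ (Fin d)) = 0 := by
  ext i; simp [toTorus]

theorem continuous_toTorus : Continuous (toTorus (d := d)) := by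
  unfold toTorus
  refine continuous_pi fun i => ?_
  exact (AddCircle.continuous_mk' 1).comp (by fun_prop)

theorem isQuotientMap_toTorus : Topology.IsQuotientMap (toTorus (d := d)) := by
  have h : IsOpenQuotientMap (Pi.map fun (_ : Fin d) (t : ℝ) => (t : UnitAddCircle)) :=
    IsOpenQuotientMap.piMap fun _ => QuotientAddGroup.isOpenQuotientMap_mk
  exact h.isQuotientMap.comp (PiLp.homeomorph 2 (fun _ : Fin d => ℝ)).isQuotientMap

theorem toTorus_surjective : Function.Surjective (toTorus (d := d)) :=
  isQuotientMap_toTorus.surjective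

theorem exists_norm_le_toTorus_eq (x : EuclideanSpace ℝ (Fin d)) :
    ∃ y : EuclideanSpace ℝ (Fin d), ‖y‖ ≤ √d ∧ toTorus y = toTorus x := by
  refine ⟨WithLp.toLp 2 fun i => Int.fract (x i), ?_, ?_⟩
  · rw [EuclideanSpace.norm_eq]
    apply Real.sqrt_le_sqrt
    calc _ ≤ ∑ _i : Fin d, (1:ℝ) := by
          gcongr with i
          simp only [Real.norm_eq_abs, Int.abs_fract]
          exact pow_le_one₀ (Int.fract_nonneg _) (Int.fract_lt_one _).le
      _ = d := by simp
  · ext i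
    simp only [toTorus, Int.fract, AddCircle.coe_sub, sub_eq_self]
    rw [AddCircle.coe_eq_zero_iff]
    exact ⟨⌊x i⌋, by simp⟩

theorem IsC2Torus.continuous {f : UnitAddTorus (Fin d) → ℝ} (hf : IsC2Torus f) : Continuous f :=
  isQuotientMap_toTorus.continuous_iff.2 (ContDiff.continuous hf)

/-- Vector-valued, so that it can be applied twice to make the second derivative periodic. -/
theorem fderiv_eq_of_toTorus_eq {F : Type*} [NormedAddCommGroup F] [NormedSpace ℝ F]
    {G : EuclideanSpace ℝ (Fin d) → F} (hG : ∀ x y, toTorus x = toTorus y → G x = G y)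
    (x y : EuclideanSpace ℝ (Fin d)) (h : toTorus x = toTorus y) :
    fderiv ℝ G x = fderiv ℝ G y := by
  have h1 : (fun z => G (z + (y - x))) = G := by
    funext z
    apply hG
    rw [toTorus_add, toTorus_sub, h, sub_self, add_zero]
  rw [← h1, fderiv_comp_add_right, add_sub_cancel, h1]

/-- The symmetric second difference of a function on an additive group. -/
def secondDiff {G : Type*} [AddGroup G] (f : G → ℝ) (x t : G) : ℝ :=
  2 * f x - f (x + t) - f (x - t)

/-- Periodicity reduces the bound on the second derivative to a compact ball. The estimate serves as
the dominating bound for h → 0 and tames the singular kernel at the origin. -/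
theorem IsC2Torus.exists_abs_secondDiff_le {f : UnitAddTorus (Fin d) → ℝ} (hf : IsC2Torus f) :
    ∃ C : ℝ, 0 ≤ C ∧ ∀ x (y : EuclideanSpace ℝ (Fin d)),
      |secondDiff f x (toTorus y)| ≤ C * ‖y‖ ^ 2 := by
  set F := fun x : EuclideanSpace ℝ (Fin d) => f (toTorus x) with hF
  have hC : ContDiff ℝ 2 F := hf
  have hcont : Continuous fun x => ‖fderiv ℝ (fderiv ℝ F) x‖ :=
    ((hC.fderiv_right (m := 1) (by norm_num)).continuous_fderiv (by norm_num)).norm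
  obtain ⟨M, hM⟩ := (isCompact_closedBall (0 : EuclideanSpace ℝ (Fin d)) (√d)).exists_bound_of_continuousOn
    hcont.continuousOn
  have hM' : ∀ x, ‖fderiv ℝ (fderiv ℝ F) x‖ ≤ M := by
    intro x
    obtain ⟨y, hy, hyx⟩ := exists_norm_le_toTorus_eq x
    rw [← fderiv_eq_of_toTorus_eq (fderiv_eq_of_toTorus_eq fun x y h => congrArg f h) y x hyx]
    exact (le_abs_self _).trans (hM y (by simpa using hy))
  have hM0 : 0 ≤ M := (norm_nonneg (fderiv ℝ (fderiv ℝ F) 0)).trans (hM' 0)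
  refine ⟨2 * M, by positivity, fun x y => ?_⟩
  obtain ⟨z, rfl⟩ := toTorus_surjective x
  have := hC.abs_second_difference_le hM' z y
  rw [secondDiff, ← toTorus_add, ← toTorus_sub, ← abs_neg]
  convert this using 2
  ring

theorem IsC2Torus.tendsto_secondDiff {f : UnitAddTorus (Fin d) → ℝ} (hf : IsC2Torus f)
    (x : UnitAddTorus (Fin d)) :
    Filter.Tendsto
      (fun h : ℝ => ∑ j, secondDiff f x (toTorus (h • EuclideanSpace.single j (1:ℝ))) / h ^ 2)
      (nhdsWithin 0 {0}ᶜ) (nhds (-torusLaplacian f x)) := by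
  obtain ⟨z, rfl⟩ := toTorus_surjective x
  have hC : ContDiff ℝ 2 (fun y : EuclideanSpace ℝ (Fin d) => f (toTorus z + toTorus y)) := by
    simp_rw [← toTorus_add]
    exact ContDiff.comp (g := fun x : EuclideanSpace ℝ (Fin d) => f (toTorus x)) hf
      (contDiff_const.add contDiff_id)
  rw [torusLaplacian, InnerProductSpace.laplacian_eq_iteratedFDeriv_orthonormalBasis _
    (EuclideanSpace.basisFun (Fin d) ℝ), ← Finset.sum_neg_distrib]
  refine tendsto_finsetSum _ fun j _ => ?_
  have := (hC.tendsto_second_difference 0 (EuclideanSpace.single j (1:ℝ))).neg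
  rw [iteratedFDeriv_two_apply]
  simp only [EuclideanSpace.basisFun_apply, Matrix.cons_val_zero, Matrix.cons_val_one]
  refine this.congr fun h => ?_
  simp only [zero_add, toTorus_neg, toTorus_zero, add_zero, secondDiff, sub_eq_add_neg]
  ring

end Torus

/-! ### Integration and Fourier coefficients on the torus. -/

section TorusIntegral

variable {d : ℕ}

theorem Continuous.integrable_torus {F : Type*} [NormedAddCommGroup F]
    {f : UnitAddTorus (Fin d) → F} (hf : Continuous f) : Integrable f (torusMeasure d) :=
  hf.integrable_of_hasCompactSupport (HasCompactSupport.of_compactSpace f)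

theorem mFourier_apply_add (n : Fin d → ℤ) (x y : UnitAddTorus (Fin d)) :
    UnitAddTorus.mFourier n (x + y) = UnitAddTorus.mFourier n x * UnitAddTorus.mFourier n y := by
  simp [UnitAddTorus.mFourier, fourier_apply, Finset.prod_mul_distrib, AddCircle.toCircle_add]

theorem mFourier_toTorus (n : Fin d → ℤ) (y : EuclideanSpace ℝ (Fin d)) :
    UnitAddTorus.mFourier n (toTorus y)
      = Complex.exp ((2 * π * ∑ i, n i * y i : ℝ) * Complex.I) := by
  simp only [UnitAddTorus.mFourier, ContinuousMap.coe_mk, toTorus, fourier_coe_apply,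
    ← Complex.exp_sum]
  congr 1
  push_cast
  rw [Finset.mul_sum, Finset.sum_mul]
  refine Finset.sum_congr rfl fun i _ => ?_
  ring

theorem mFourierCoeff_eq_integral_torusMeasure (f : UnitAddTorus (Fin d) → ℂ) (n : Fin d → ℤ) :
    UnitAddTorus.mFourierCoeff f n = ∫ t, UnitAddTorus.mFourier (-n) t * f t ∂torusMeasure d := rfl

theorem mFourierCoeff_translate (f : UnitAddTorus (Fin d) → ℂ) (n : Fin d → ℤ)
    (t : UnitAddTorus (Fin d)) :
    UnitAddTorus.mFourierCoeff (fun x => f (x + t)) n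
      = UnitAddTorus.mFourier n t * UnitAddTorus.mFourierCoeff f n := by
  simp only [mFourierCoeff_eq_integral_torusMeasure]
  rw [← integral_const_mul, ← integral_add_right_eq_self
    (fun x => UnitAddTorus.mFourier n t * (UnitAddTorus.mFourier (-n) x * f x)) t]
  refine integral_congr_ae (Filter.Eventually.of_forall fun x => ?_)
  simp only
  have h : UnitAddTorus.mFourier n t * UnitAddTorus.mFourier (-n) t = 1 := by
    rw [← UnitAddTorus.mFourier_add, add_neg_cancel, UnitAddTorus.mFourier_zero]
    rfl
  rw [mFourier_apply_add]
  linear_combination -(UnitAddTorus.mFourier (-n) x * f (x + t)) * h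

theorem hasSum_sq_mFourierCoeff_of_continuous {f : UnitAddTorus (Fin d) → ℂ} (hf : Continuous f) :
    HasSum (fun n => ‖UnitAddTorus.mFourierCoeff f n‖ ^ 2) (∫ t, ‖f t‖ ^ 2 ∂torusMeasure d) := by
  set g : C(UnitAddTorus (Fin d), ℂ) := ⟨f, hf⟩
  have := UnitAddTorus.hasSum_sq_mFourierCoeff (g.toLp 2 (torusMeasure d) ℂ)
  have e : ∀ n, UnitAddTorus.mFourierCoeff (g.toLp 2 (torusMeasure d) ℂ) n
      = UnitAddTorus.mFourierCoeff f n := UnitAddTorus.mFourierCoeff_toLp g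
  simp_rw [e] at this
  convert! this using 1
  refine integral_congr_ae ?_
  filter_upwards [g.coeFn_toLp (p := 2) (𝕜 := ℂ) (torusMeasure d)] with x hx
  rw [hx]
  rfl

theorem measurePreserving_toTorus :
    MeasurePreserving (toTorus (d := d)) (volume.restrict {x | ∀ i, x i ∈ Set.Ioc (0:ℝ) 1})
      (torusMeasure d) := by
  have h1 : MeasurePreserving (fun (x : Fin d → ℝ) (i : Fin d) => (x i : UnitAddCircle))
      (Measure.pi fun _ : Fin d => volume.restrict (Set.Ioc (0:ℝ) (0 + 1)))
      (Measure.pi fun _ : Fin d => volume) :=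
    measurePreserving_pi _ _ (fun _ : Fin d => UnitAddCircle.measurePreserving_mk 0)
  have h3 : MeasurableSet (Set.univ.pi fun _ : Fin d => Set.Ioc (0:ℝ) (0 + 1)) :=
    MeasurableSet.univ_pi fun _ => measurableSet_Ioc
  rw [← Measure.restrict_pi_pi] at h1
  have := h1.comp ((PiLp.volume_preserving_ofLp (Fin d)).restrict_preimage h3)
  rw [torusMeasure_eq_volume]
  have e : {x : EuclideanSpace ℝ (Fin d) | ∀ i, x i ∈ Set.Ioc (0:ℝ) 1}
      = WithLp.ofLp ⁻¹' Set.univ.pi fun _ => Set.Ioc (0:ℝ) (0 + 1) := by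
    ext x
    simp
  rw [e]
  exact this

/-- Discrete integration by parts: split the second difference into two first differences and
translate one of them by `t`. -/
theorem integral_secondDiff_mul {f ψ : UnitAddTorus (Fin d) → ℝ} (hf : Continuous f)
    (hψ : Continuous ψ) (t : UnitAddTorus (Fin d)) :
    ∫ x, secondDiff f x t * ψ x ∂torusMeasure d
      = ∫ x, (f x - f (x + t)) * (ψ x - ψ (x + t)) ∂torusMeasure d := by
  have h1 : Integrable (fun x => (f x - f (x + t)) * ψ x) (torusMeasure d) :=
    Continuous.integrable_torus (by fun_prop)
  have h2 : Integrable (fun x => (f x - f (x - t)) * ψ x) (torusMeasure d) :=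
    Continuous.integrable_torus (by fun_prop)
  have h3 : Integrable (fun x => (f (x + t) - f x) * ψ (x + t)) (torusMeasure d) :=
    Continuous.integrable_torus (by fun_prop)
  calc _ = ∫ x, ((f x - f (x + t)) * ψ x + (f x - f (x - t)) * ψ x) ∂torusMeasure d := by
        congr 1; funext x; rw [secondDiff]; ring
    _ = ∫ x, (f x - f (x + t)) * ψ x ∂torusMeasure d
        + ∫ x, (f (x + t) - f x) * ψ (x + t) ∂torusMeasure d := by
        rw [integral_add h1 h2, ← integral_add_right_eq_self (fun x => (f x - f (x - t)) * ψ x) t]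
        simp only [add_sub_cancel_right]
    _ = _ := by
        rw [← integral_add h1 h3]
        congr 1; funext x; ring

/-- After averaging over `t`, x and x + t are independent, so the cross terms factor through ∫ f =
0. -/
theorem integral_integral_secondDiff_mul {f ψ : UnitAddTorus (Fin d) → ℝ} (hf : Continuous f)
    (hψ : Continuous ψ) (h0 : HasMeanZero f) :
    ∫ t, ∫ x, secondDiff f x t * ψ x ∂torusMeasure d ∂torusMeasure d
      = 2 * ∫ x, f x * ψ x ∂torusMeasure d := by
  simp_rw [integral_secondDiff_mul hf hψ]
  rw [integral_integral_swap]
  swap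
  · exact Continuous.integrable_of_hasCompactSupport (by unfold Function.uncurry; fun_prop)
      (HasCompactSupport.of_compactSpace _)
  have h0' : ∫ x, f x ∂torusMeasure d = 0 := h0
  have inner : ∀ x, ∫ t, (f x - f (x + t)) * (ψ x - ψ (x + t)) ∂torusMeasure d
      = f x * ψ x - f x * ∫ t, ψ t ∂torusMeasure d + ∫ t, f t * ψ t ∂torusMeasure d := by
    intro x
    rw [integral_add_left_eq_self (fun t => (f x - f t) * (ψ x - ψ t)) x]
    have e : ∀ t, (f x - f t) * (ψ x - ψ t) = f x * ψ x - f x * ψ t - f t * ψ x + f t * ψ t :=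
      fun t => by ring
    simp_rw [e]
    rw [integral_add (Continuous.integrable_torus (by fun_prop))
        (Continuous.integrable_torus (by fun_prop)),
      integral_sub (Continuous.integrable_torus (by fun_prop))
        (Continuous.integrable_torus (by fun_prop)),
      integral_sub (Continuous.integrable_torus (by fun_prop))
        (Continuous.integrable_torus (by fun_prop)), integral_mul_const (ψ x) f, integral_const_mul (f x) ψ, h0']
    simp
  simp_rw [inner]
  rw [integral_add (Continuous.integrable_torus (by fun_prop))
      (Continuous.integrable_torus (by fun_prop)),
    integral_sub (Continuous.integrable_torus (by fun_prop))
      (Continuous.integrable_torus (by fun_prop)), integral_mul_const, h0']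
  simp
  ring

variable {f : UnitAddTorus (Fin d) → ℝ}

/-- For mean zero `f`, the mean of the signed power of `f` of exponent `q / 2` is at most a fixed
fraction of its `L²` norm. -/
theorem sq_integral_signedPow_le (hf : Continuous f) (h0 : HasMeanZero f) {q : ℝ} (hq : 1 < q) :
    2 * (∫ x, signedPow (q / 2) (f x) ∂torusMeasure d) ^ 2 ≤ ∫ x, |f x| ^ q ∂torusMeasure d := by
  have h0' : ∫ x, f x ∂torusMeasure d = 0 := h0
  have hcu : Continuous fun x => signedPow (q / 2) (f x) :=
    (continuous_signedPow (by linarith)).comp hf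
  have hcψ : Continuous fun x => signedPow (q - 1) (f x) :=
    (continuous_signedPow (by linarith)).comp hf
  have hcS : Continuous fun x => |f x| ^ q :=
    hf.abs.rpow_const fun _ => Or.inr (by linarith)
  set S := ∫ x, |f x| ^ q ∂torusMeasure d
  set U := ∫ x, signedPow (q / 2) (f x) ∂torusMeasure d
  set Φ := ∫ x, signedPow (q - 1) (f x) ∂torusMeasure d
  -- The converse inequality, expanded. The mixed terms are linear in `a` or in `b`, so they vanish
  -- when both are replaced by values of `f` and integrated.
  have hp : ∀ a b : ℝ, 4 * (signedPow (q / 2) a * signedPow (q / 2) b)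
      ≤ |a| ^ q + |b| ^ q + a * signedPow (q - 1) b + b * signedPow (q - 1) a := by
    intro a b
    have h1 := sub_mul_signedPow_sub_le hq a b
    have h2 := mul_signedPow (r := q - 1) (by linarith) a
    have h3 := mul_signedPow (r := q - 1) (by linarith) b
    have h4 := signedPow_sq (r := q / 2) (by linarith) a
    have h5 := signedPow_sq (r := q / 2) (by linarith) b
    rw [sub_add_cancel] at h2 h3
    rw [mul_div_cancel₀ _ two_ne_zero] at h4 h5
    nlinarith
  have inner : ∀ a : ℝ, 4 * (signedPow (q / 2) a * U) ≤ |a| ^ q + S + a * Φ := by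
    intro a
    have := integral_mono (μ := torusMeasure d)
      (Continuous.integrable_torus (by fun_prop)) (Continuous.integrable_torus (by fun_prop))
      (fun y => hp a (f y))
    rw [integral_const_mul, integral_const_mul,
      integral_add (Continuous.integrable_torus (by fun_prop))
        (Continuous.integrable_torus (by fun_prop)),
      integral_add (Continuous.integrable_torus (by fun_prop))
        (Continuous.integrable_torus (by fun_prop)),
      integral_add (Continuous.integrable_torus (by fun_prop))
        (Continuous.integrable_torus (by fun_prop)),
      integral_mul_const, integral_const_mul, h0'] at this
    simpa using this
  have := integral_mono (μ := torusMeasure d)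
    (Continuous.integrable_torus (by fun_prop)) (Continuous.integrable_torus (by fun_prop))
    (fun x => inner (f x))
  rw [integral_const_mul, integral_mul_const,
    integral_add (Continuous.integrable_torus (by fun_prop))
      (Continuous.integrable_torus (by fun_prop)),
    integral_add (Continuous.integrable_torus (by fun_prop))
      (Continuous.integrable_torus (by fun_prop)), integral_mul_const, h0'] at this
  simp at this
  change 4 * (U * U) ≤ S + S at this
  nlinarith

end TorusIntegral

/-! ### The Laplacian bound. -/

section Laplacian

variable {d : ℕ} {f : UnitAddTorus (Fin d) → ℝ}

/-- Bessel's inequality for a translation difference. Finitely many frequencies suffice and let the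
later limit be taken termwise. -/
theorem sum_sq_mFourierCoeff_le_integral_sq_sub {u : UnitAddTorus (Fin d) → ℝ} (hu : Continuous u)
    (F : Finset (Fin d → ℤ)) (t : UnitAddTorus (Fin d)) :
    ∑ n ∈ F, ‖UnitAddTorus.mFourier n t - 1‖ ^ 2
        * ‖UnitAddTorus.mFourierCoeff (fun x => (u x : ℂ)) n‖ ^ 2
      ≤ ∫ x, (u x - u (x + t)) ^ 2 ∂torusMeasure d := by
  have hc : Continuous fun x => (u (x + t) : ℂ) - u x := by fun_prop
  have h1 := hasSum_sq_mFourierCoeff_of_continuous hc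
  have h2 : ∀ n, UnitAddTorus.mFourierCoeff (fun x => (u (x + t) : ℂ) - u x) n
      = (UnitAddTorus.mFourier n t - 1) * UnitAddTorus.mFourierCoeff (fun x => (u x : ℂ)) n := by
    intro n
    rw [sub_mul, one_mul, ← mFourierCoeff_translate]
    simp only [mFourierCoeff_eq_integral_torusMeasure]
    rw [← integral_sub (Continuous.integrable_torus (by fun_prop))
      (Continuous.integrable_torus (by fun_prop))]
    simp only [mul_sub]
  have h3 : ∫ x, ‖(u (x + t) : ℂ) - u x‖ ^ 2 ∂torusMeasure d
      = ∫ x, (u x - u (x + t)) ^ 2 ∂torusMeasure d := by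
    congr 1
    funext x
    rw [← Complex.ofReal_sub, Complex.norm_real, Real.norm_eq_abs, sq_abs]
    ring
  rw [h3] at h1
  simp_rw [h2, norm_mul, mul_pow] at h1
  exact sum_le_hasSum F (fun n _ => by positivity) h1

theorem tendsto_norm_mFourier_sub_one_sq (n : Fin d → ℤ) (j : Fin d) :
    Filter.Tendsto (fun h : ℝ => ‖UnitAddTorus.mFourier n
        (toTorus (h • EuclideanSpace.single j (1:ℝ))) - 1‖ ^ 2 / h ^ 2)
      (nhdsWithin 0 {0}ᶜ) (nhds (4 * π ^ 2 * (n j : ℝ) ^ 2)) := by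
  have hd : HasDerivAt (fun h : ℝ => Complex.exp ((2 * π * n j * h : ℝ) * Complex.I))
      ((2 * π * n j : ℝ) * Complex.I) 0 := by
    have h1 : HasDerivAt (fun h : ℝ => ((2 * π * n j * h : ℝ) : ℂ) * Complex.I)
        ((2 * π * n j : ℝ) * Complex.I) 0 := by
      have := ((hasDerivAt_id (0:ℝ)).const_mul (2 * π * n j)).ofReal_comp.mul_const Complex.I
      simpa using this
    simpa using h1.cexp
  have hs := ((hasDerivAt_iff_tendsto_slope_zero.1 hd).norm.pow 2)
  have e : ‖((2 * π * n j : ℝ) : ℂ) * Complex.I‖ ^ 2 = 4 * π ^ 2 * (n j : ℝ) ^ 2 := by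
    rw [norm_mul, Complex.norm_I, mul_one, Complex.norm_real, Real.norm_eq_abs, sq_abs]
    ring
  rw [e] at hs
  refine hs.congr fun h => ?_
  rw [mFourier_toTorus]
  have e2 : ∑ i, (n i : ℝ) * (h • EuclideanSpace.single j (1:ℝ)) i = n j * h := by
    simp [Finset.sum_ite_eq']
  rw [e2, norm_smul, mul_pow, norm_inv, inv_pow, Real.norm_eq_abs, sq_abs, div_eq_inv_mul]
  simp [mul_assoc]

theorem integral_secondDiff_mul_signedPow_ge (hf : Continuous f) {q : ℝ} (hq : 1 < q)
    (t : UnitAddTorus (Fin d)) :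
    4 * (q - 1) / q ^ 2
        * ∫ x, (signedPow (q / 2) (f x) - signedPow (q / 2) (f (x + t))) ^ 2 ∂torusMeasure d
      ≤ ∫ x, secondDiff f x t * signedPow (q - 1) (f x) ∂torusMeasure d := by
  have hcu : Continuous fun x => signedPow (q / 2) (f x) :=
    (continuous_signedPow (by linarith)).comp hf
  have hcu' : Continuous fun x => signedPow (q / 2) (f (x + t)) := hcu.comp (by fun_prop)
  have hcψ : Continuous fun x => signedPow (q - 1) (f x) :=
    (continuous_signedPow (by linarith)).comp hf
  have hcψ' : Continuous fun x => signedPow (q - 1) (f (x + t)) := hcψ.comp (by fun_prop)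
  rw [integral_secondDiff_mul hf hcψ, ← integral_const_mul]
  exact integral_mono (Continuous.integrable_torus (by fun_prop))
    (Continuous.integrable_torus (by fun_prop)) fun x => signedPow_stroockVaropoulos hq _ _

theorem IsC2Torus.tendsto_integral_secondDiff (hf : IsC2Torus f) {ψ : UnitAddTorus (Fin d) → ℝ}
    (hψ : Continuous ψ) :
    Filter.Tendsto (fun h : ℝ => ∑ j, (∫ x, secondDiff f x
        (toTorus (h • EuclideanSpace.single j (1:ℝ))) * ψ x ∂torusMeasure d) / h ^ 2)
      (nhdsWithin 0 {0}ᶜ) (nhds (-∫ x, torusLaplacian f x * ψ x ∂torusMeasure d)) := by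
  have hc := hf.continuous
  obtain ⟨C, hC0, hC⟩ := hf.exists_abs_secondDiff_le
  have hcs : ∀ t, Continuous fun x => secondDiff f x t := fun t => by
    unfold secondDiff; fun_prop
  have e : ∀ h : ℝ, ∑ j, (∫ x, secondDiff f x
        (toTorus (h • EuclideanSpace.single j (1:ℝ))) * ψ x ∂torusMeasure d) / h ^ 2
      = ∫ x, (∑ j, secondDiff f x (toTorus (h • EuclideanSpace.single j (1:ℝ))) / h ^ 2) * ψ x
        ∂torusMeasure d := by
    intro h
    simp_rw [Finset.sum_mul]
    rw [integral_finsetSum]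
    · refine Finset.sum_congr rfl fun j _ => ?_
      rw [← integral_div]
      congr 1
      funext x
      ring
    · intro j _
      exact Continuous.integrable_torus (((hcs _).div_const _).mul hψ)
  simp_rw [e]
  rw [← integral_neg]
  refine tendsto_integral_filter_of_dominated_convergence (fun x => (d * C) * |ψ x|) ?_ ?_ ?_ ?_
  · refine Filter.Eventually.of_forall fun h => Continuous.aestronglyMeasurable ?_
    exact (continuous_finsetSum _ fun j _ => (hcs _).div_const _).mul hψ
  · filter_upwards [self_mem_nhdsWithin] with h hh
    refine Filter.Eventually.of_forall fun x => ?_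
    rw [norm_mul, Real.norm_eq_abs, Real.norm_eq_abs]
    gcongr
    refine (Finset.abs_sum_le_sum_abs _ _).trans ?_
    calc _ ≤ ∑ _j : Fin d, C := by
          gcongr with j
          rw [abs_div, abs_of_nonneg (sq_nonneg h), div_le_iff₀ (sq_pos_of_ne_zero hh)]
          refine (hC x _).trans_eq ?_
          simp [norm_smul]
      _ = _ := by simp
  · exact Continuous.integrable_torus (by fun_prop)
  · refine Filter.Eventually.of_forall fun x => ?_
    rw [← neg_mul]
    exact (hf.tendsto_secondDiff x).mul_const _

/-- The spectral gap of the torus, uniform in the dimension. -/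
theorem one_le_sum_sq_of_ne_zero {n : Fin d → ℤ} (hn : n ≠ 0) : 1 ≤ ∑ j, (n j : ℝ) ^ 2 := by
  obtain ⟨j, hj⟩ := Function.ne_iff.1 hn
  have h1 : (1:ℝ) ≤ (n j : ℝ) ^ 2 := by
    have : (1:ℤ) ≤ n j ^ 2 := Int.add_one_le_iff.2 (sq_pos_of_ne_zero hj)
    exact_mod_cast this
  exact h1.trans (Finset.single_le_sum (f := fun j => (n j : ℝ) ^ 2) (fun i _ => sq_nonneg _)
    (Finset.mem_univ j))

/-- For q < 2 the signed power of exponent q/2 is not differentiable at 0, so its Dirichlet energy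
is reached through difference quotients. Summed over directions, their multipliers tend to 4π²|n|².
-/
theorem sum_sq_mFourierCoeff_signedPow_le (hf : IsC2Torus f) {q : ℝ} (hq : 1 < q)
    (F : Finset (Fin d → ℤ)) (hF : 0 ∉ F) :
    4 * (q - 1) / q ^ 2 * (4 * π ^ 2) * ∑ n ∈ F,
        ‖UnitAddTorus.mFourierCoeff (fun x => (signedPow (q / 2) (f x) : ℂ)) n‖ ^ 2
      ≤ -∫ x, torusLaplacian f x * signedPow (q - 1) (f x) ∂torusMeasure d := by
  have hq0 : 0 < q - 1 := by linarith
  have hcu : Continuous fun x => signedPow (q / 2) (f x) :=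
    (continuous_signedPow (by linarith)).comp hf.continuous
  have hcψ : Continuous fun x => signedPow (q - 1) (f x) :=
    (continuous_signedPow (by linarith)).comp hf.continuous
  set c := fun n => ‖UnitAddTorus.mFourierCoeff (fun x => (signedPow (q / 2) (f x) : ℂ)) n‖ ^ 2
  have lim : Filter.Tendsto (fun h : ℝ => ∑ j : Fin d, 4 * (q - 1) / q ^ 2 * ∑ n ∈ F,
      ‖UnitAddTorus.mFourier n (toTorus (h • EuclideanSpace.single j (1:ℝ))) - 1‖ ^ 2 / h ^ 2 * c n)
      (nhdsWithin 0 {0}ᶜ)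
      (nhds (∑ j : Fin d, 4 * (q - 1) / q ^ 2 * ∑ n ∈ F, 4 * π ^ 2 * (n j : ℝ) ^ 2 * c n)) :=
    tendsto_finsetSum _ fun j _ => (tendsto_finsetSum _ fun n _ =>
      (tendsto_norm_mFourier_sub_one_sq n j).mul_const _).const_mul _
  have hle := le_of_tendsto_of_tendsto' lim (hf.tendsto_integral_secondDiff hcψ) fun h => by
    refine Finset.sum_le_sum fun j _ => ?_
    have h1 := sum_sq_mFourierCoeff_le_integral_sq_sub hcu F
      (toTorus (h • EuclideanSpace.single j (1:ℝ)))
    have h2 := integral_secondDiff_mul_signedPow_ge hf.continuous hq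
      (toTorus (h • EuclideanSpace.single j (1:ℝ)))
    calc _ = (4 * (q - 1) / q ^ 2 * ∑ n ∈ F, ‖UnitAddTorus.mFourier n
            (toTorus (h • EuclideanSpace.single j (1:ℝ))) - 1‖ ^ 2 * c n) / h ^ 2 := by
          rw [mul_div_assoc (4 * (q - 1) / q ^ 2), Finset.sum_div]
          congr 1
          refine Finset.sum_congr rfl fun n _ => ?_
          ring
      _ ≤ _ := by
          gcongr
          exact le_trans (by gcongr) h2
  refine le_trans ?_ hle
  rw [← Finset.mul_sum, Finset.sum_comm, mul_assoc]
  gcongr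
  rw [Finset.mul_sum]
  refine Finset.sum_le_sum fun n hn => ?_
  have hn0 : n ≠ 0 := fun h => hF (h ▸ hn)
  rw [← Finset.sum_mul, ← Finset.mul_sum]
  exact mul_le_mul_of_nonneg_right
    (le_mul_of_one_le_right (by positivity) (one_le_sum_sq_of_ne_zero hn0)) (by positivity)

/-- Parseval, with the zero mode absorbed by `sq_integral_signedPow_le`; this halves the constant
16π². -/
theorem IsC2Torus.integral_laplacian_mul_signedPow_ge (hf : IsC2Torus f) (h0 : HasMeanZero f)
    {q : ℝ} (hq : 1 < q) :
    8 * π ^ 2 * ((q - 1) / q ^ 2) * ∫ x, |f x| ^ q ∂torusMeasure d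
      ≤ -∫ x, torusLaplacian f x * signedPow (q - 1) (f x) ∂torusMeasure d := by
  have hq0 : 0 < q - 1 := by linarith
  have hcu : Continuous fun x => signedPow (q / 2) (f x) :=
    (continuous_signedPow (by linarith)).comp hf.continuous
  set L := -∫ x, torusLaplacian f x * signedPow (q - 1) (f x) ∂torusMeasure d
  set U := ∫ x, signedPow (q / 2) (f x) ∂torusMeasure d with hU
  have hS := hasSum_sq_mFourierCoeff_of_continuous
    (f := fun x => (signedPow (q / 2) (f x) : ℂ)) (by fun_prop)
  have e : ∫ x, ‖(signedPow (q / 2) (f x) : ℂ)‖ ^ 2 ∂torusMeasure d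
      = ∫ x, |f x| ^ q ∂torusMeasure d := by
    congr 1
    funext x
    rw [Complex.norm_real, Real.norm_eq_abs, sq_abs, signedPow_sq (by linarith),
      mul_div_cancel₀ _ two_ne_zero]
  rw [e] at hS
  have c0 : ‖UnitAddTorus.mFourierCoeff (fun x => (signedPow (q / 2) (f x) : ℂ)) 0‖ ^ 2 = U ^ 2 := by
    rw [mFourierCoeff_eq_integral_torusMeasure, neg_zero, UnitAddTorus.mFourier_zero]
    simp only [ContinuousMap.one_apply, one_mul]
    rw [integral_complex_ofReal, Complex.norm_real, Real.norm_eq_abs, sq_abs]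
  have hκ : 0 < 4 * (q - 1) / q ^ 2 * (4 * π ^ 2) := by positivity
  have hb : ∫ x, |f x| ^ q ∂torusMeasure d ≤ L / (4 * (q - 1) / q ^ 2 * (4 * π ^ 2)) + U ^ 2 := by
    refine hasSum_le_of_sum_le hS fun F => ?_
    have h1 := sum_sq_mFourierCoeff_signedPow_le hf hq (F.erase 0) (Finset.notMem_erase 0 F)
    rw [← le_div_iff₀' hκ] at h1
    rw [← c0]
    by_cases hF : 0 ∈ F
    · rw [← Finset.sum_erase_add _ _ hF]
      gcongr
    · rw [Finset.erase_eq_of_notMem hF] at h1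
      exact h1.trans (le_add_of_nonneg_right (by positivity))
  have hU2 := sq_integral_signedPow_le hf.continuous h0 hq
  rw [← hU] at hU2
  have : (∫ x, |f x| ^ q ∂torusMeasure d) / 2 ≤ L / (4 * (q - 1) / q ^ 2 * (4 * π ^ 2)) := by
    linarith
  rw [le_div_iff₀ hκ] at this
  refine le_of_eq_of_le ?_ this
  ring

end Laplacian

/-! ### The kernel and its Fourier symbol. -/

section FracKernel

variable {d : ℕ} {α : ℝ}

/-- The kernel `|y| ^ (-(d + α))` of the fractional Laplacian of order `α` on `ℝ^d`. -/
noncomputable def fracKernel (α : ℝ) (y : EuclideanSpace ℝ (Fin d)) : ℝ := ‖y‖ ^ (-(d + α))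

theorem fracKernel_nonneg (y : EuclideanSpace ℝ (Fin d)) : 0 ≤ fracKernel α y :=
  Real.rpow_nonneg (norm_nonneg y) _

theorem measurable_fracKernel : Measurable (fracKernel (d := d) α) := by
  unfold fracKernel; fun_prop

/-- In polar coordinates the integrand is r^(1-α) near 0 and r^(-1-α) at infinity: the first needs α
< 2, the second α > 0. -/
theorem integrable_min_mul_fracKernel (hd : 1 ≤ d) (h0 : 0 < α) (h2 : α < 2) :
    Integrable fun y : EuclideanSpace ℝ (Fin d) => min (‖y‖ ^ 2) 1 * fracKernel α y := by
  have : Nonempty (Fin d) := ⟨⟨0, hd⟩⟩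
  unfold fracKernel
  rw [integrable_fun_norm_addHaar (E := EuclideanSpace ℝ (Fin d)) volume
    (f := fun r : ℝ => min (r ^ 2) 1 * r ^ (-(d + α))), finrank_euclideanSpace_fin,
    ← Set.Ioc_union_Ioi_eq_Ioi (zero_le_one (α := ℝ)), integrableOn_union]
  have hp : ∀ r : ℝ, 0 < r → r ^ (d - 1) = r ^ ((d:ℝ) - 1) := fun r hr => by
    rw [← Real.rpow_natCast, Nat.cast_sub hd, Nat.cast_one]
  constructor
  · have h : IntegrableOn (fun r : ℝ => r ^ (1 - α)) (Set.Ioc 0 1) :=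
      (intervalIntegrable_iff_integrableOn_Ioc_of_le zero_le_one).1
        (intervalIntegral.intervalIntegrable_rpow' (by linarith))
    refine h.congr_fun (fun r hr => ?_) measurableSet_Ioc
    have hr0 : 0 < r := hr.1
    simp only [smul_eq_mul]
    rw [min_eq_left (pow_le_one₀ hr0.le hr.2), hp r hr0, ← Real.rpow_natCast r 2,
      ← Real.rpow_add hr0, ← Real.rpow_add hr0]
    congr 1
    push_cast
    ring
  · have h : IntegrableOn (fun r : ℝ => r ^ (-1 - α)) (Set.Ioi 1) :=
      integrableOn_Ioi_rpow_of_lt (by linarith) zero_lt_one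
    refine h.congr_fun (fun r hr => ?_) measurableSet_Ioi
    have hr1 : 1 < r := hr
    have hr0 : 0 < r := by linarith
    simp only [smul_eq_mul]
    rw [min_eq_right (one_le_pow₀ hr1.le), hp r hr0, one_mul, ← Real.rpow_add hr0]
    congr 1
    ring

theorem abs_mul_fracKernel_le {C s : ℝ} {y : EuclideanSpace ℝ (Fin d)}
    (h1 : |s| ≤ C * ‖y‖ ^ 2) (h2 : |s| ≤ C) :
    ‖s * fracKernel α y‖ ≤ C * (min (‖y‖ ^ 2) 1 * fracKernel α y) := by
  rw [norm_mul, Real.norm_eq_abs, Real.norm_eq_abs, abs_of_nonneg (fracKernel_nonneg y), ← mul_assoc]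
  refine mul_le_mul_of_nonneg_right ?_ (fracKernel_nonneg y)
  rcases min_choice (‖y‖ ^ 2) 1 with h | h <;> rw [h]
  · exact h1
  · simpa using h2

theorem integrable_one_sub_cos_mul_fracKernel (hd : 1 ≤ d) (h0 : 0 < α) (h2 : α < 2)
    (ξ : EuclideanSpace ℝ (Fin d)) :
    Integrable fun y => (1 - cos (inner ℝ ξ y)) * fracKernel α y := by
  refine ((integrable_min_mul_fracKernel hd h0 h2).const_mul (max (‖ξ‖ ^ 2 / 2) 2)).mono'
    ((Continuous.measurable (by fun_prop)).mul measurable_fracKernel).aestronglyMeasurable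
    (Filter.Eventually.of_forall fun y => abs_mul_fracKernel_le ?_ ?_)
  · rw [abs_of_nonneg (by linarith [cos_le_one (inner ℝ ξ y)])]
    have h3 := Real.one_sub_sq_div_two_le_cos (x := inner ℝ ξ y)
    have h4 : (inner ℝ ξ y) ^ 2 ≤ (‖ξ‖ * ‖y‖) ^ 2 := by
      rw [← sq_abs]
      gcongr
      exact abs_real_inner_le_norm ξ y
    calc _ ≤ ‖ξ‖ ^ 2 / 2 * ‖y‖ ^ 2 := by nlinarith
      _ ≤ _ := by gcongr; exact le_max_left _ _
  · rw [abs_of_nonneg (by linarith [cos_le_one (inner ℝ ξ y)])]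
    exact le_trans (by linarith [neg_one_le_cos (inner ℝ ξ y)]) (le_max_right _ _)

/-- The Fourier symbol of the (unnormalised) fractional Laplacian. -/
noncomputable def fracSymbol (α : ℝ) (ξ : EuclideanSpace ℝ (Fin d)) : ℝ :=
  ∫ y, (1 - cos (inner ℝ ξ y)) * fracKernel α y

theorem fracSymbol_smul {r : ℝ} (hr : 0 < r) (ξ : EuclideanSpace ℝ (Fin d)) :
    fracSymbol α (r • ξ) = r ^ α * fracSymbol α ξ := by
  have h1 : ∀ y : EuclideanSpace ℝ (Fin d), (1 - cos (inner ℝ (r • ξ) y)) * fracKernel α y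
      = r ^ (d + α) * ((1 - cos (inner ℝ ξ (r • y))) * fracKernel α (r • y)) := by
    intro y
    rw [fracKernel, fracKernel, norm_smul, Real.norm_eq_abs, abs_of_pos hr,
      Real.mul_rpow hr.le (norm_nonneg y), inner_smul_left, inner_smul_right, Real.rpow_neg hr.le]
    have : r ^ ((d:ℝ) + α) ≠ 0 := (Real.rpow_pos_of_pos hr _).ne'
    field_simp
    simp
    ring_nf
  rw [fracSymbol]
  simp_rw [h1]
  rw [integral_const_mul, Measure.integral_comp_smul volume
    (fun y : EuclideanSpace ℝ (Fin d) => (1 - cos (inner ℝ ξ y)) * fracKernel α y) r,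
    finrank_euclideanSpace_fin, abs_of_pos (by positivity), smul_eq_mul, ← mul_assoc, fracSymbol,
    Real.rpow_add hr, Real.rpow_natCast]
  congr 1
  field_simp

/-- The reflection exchanging ξ and η preserves both Lebesgue measure and the kernel. -/
theorem fracSymbol_eq_of_norm_eq {ξ η : EuclideanSpace ℝ (Fin d)} (h : ‖ξ‖ = ‖η‖) :
    fracSymbol α ξ = fracSymbol α η := by
  set ρ := (ℝ ∙ (ξ - η))ᗮ.reflection
  have hρ : ρ ξ = η := Submodule.reflection_sub h
  rw [fracSymbol, fracSymbol, ← ρ.measurePreserving.integral_comp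
    ρ.toHomeomorph.measurableEmbedding (fun y => (1 - cos (inner ℝ η y)) * fracKernel α y)]
  simp only [← hρ, fracKernel, LinearIsometryEquiv.inner_map_map, LinearIsometryEquiv.norm_map]

/-- The integrand is positive on the nonempty open slab 0 < ⟨ξ, y⟩ < 2π. -/
theorem fracSymbol_pos (hd : 1 ≤ d) (h0 : 0 < α) (h2 : α < 2) {ξ : EuclideanSpace ℝ (Fin d)}
    (hξ : ξ ≠ 0) : 0 < fracSymbol α ξ := by
  have hn : ∀ y, 0 ≤ (1 - cos (inner ℝ ξ y)) * fracKernel α y := fun y =>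
    mul_nonneg (by linarith [cos_le_one (inner ℝ ξ y)]) (fracKernel_nonneg y)
  rw [fracSymbol, integral_pos_iff_support_of_nonneg hn
    (integrable_one_sub_cos_mul_fracKernel hd h0 h2 ξ)]
  have ho : IsOpen {y : EuclideanSpace ℝ (Fin d) | inner ℝ ξ y ∈ Set.Ioo 0 (2 * π)} :=
    isOpen_Ioo.preimage (by fun_prop)
  refine lt_of_lt_of_le (ho.measure_pos volume ⟨(‖ξ‖ ^ 2)⁻¹ • ξ, ?_⟩) (measure_mono fun y hy => ?_)
  · have : ‖ξ‖ ^ 2 ≠ 0 := by positivity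
    simp only [Set.mem_ofPred_eq, inner_smul_right, real_inner_self_eq_norm_sq, inv_mul_cancel₀ this]
    exact ⟨one_pos, by linarith [pi_gt_three]⟩
  · have hy1 : (inner ℝ ξ y : ℝ) ∈ Set.Ioo 0 (2 * π) := hy
    have hy0 : y ≠ 0 := by rintro rfl; simp at hy1
    have hc : cos (inner ℝ ξ y) ≠ 1 := by
      intro hc
      rw [Real.cos_eq_one_iff_of_lt_of_lt (by linarith [hy1.1, pi_pos]) hy1.2] at hc
      exact hy1.1.ne' hc
    rw [Function.mem_support]
    exact mul_ne_zero (sub_ne_zero.2 hc.symm) (Real.rpow_pos_of_pos (norm_pos_iff.2 hy0) _).ne'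

/-- A radial function homogeneous of degree α is a multiple of ‖ξ‖^α; the value of `A` is never
computed. -/
theorem exists_fracSymbol_eq (hd : 1 ≤ d) (h0 : 0 < α) (h2 : α < 2) :
    ∃ A : ℝ, 0 < A ∧ ∀ ξ : EuclideanSpace ℝ (Fin d), fracSymbol α ξ = ‖ξ‖ ^ α * A := by
  set e : EuclideanSpace ℝ (Fin d) := EuclideanSpace.single ⟨0, hd⟩ 1
  have he : ‖e‖ = 1 := by simp [e]
  refine ⟨fracSymbol α e, fracSymbol_pos hd h0 h2 (norm_pos_iff.1 (by rw [he]; exact one_pos)),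
    fun ξ => ?_⟩
  rcases eq_or_ne ξ 0 with rfl | hξ
  · simp [fracSymbol, Real.zero_rpow h0.ne']
  · rw [← fracSymbol_smul (norm_pos_iff.2 hξ)]
    exact fracSymbol_eq_of_norm_eq (by rw [norm_smul, he, norm_norm, mul_one])

end FracKernel

/-! ### The fractional Laplacian as a hypersingular integral, and its lower bound. -/

section FracLaplacian

variable {d : ℕ} {α : ℝ} {f : UnitAddTorus (Fin d) → ℝ}

/-- Pairing with an integrable function is continuous in the uniform norm, and trigonometric
polynomials are dense. -/
theorem integral_mul_eq_zero_of_mFourierCoeff_eq_zero {h : UnitAddTorus (Fin d) → ℂ}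
    (hi : Integrable h (torusMeasure d)) (hz : ∀ n, UnitAddTorus.mFourierCoeff h n = 0)
    (χ : C(UnitAddTorus (Fin d), ℂ)) : ∫ x, χ x * h x ∂torusMeasure d = 0 := by
  have hint : ∀ χ : C(UnitAddTorus (Fin d), ℂ), Integrable (fun x => χ x * h x) (torusMeasure d) :=
    fun χ => hi.bdd_mul χ.continuous.aestronglyMeasurable
      (Filter.Eventually.of_forall fun x => χ.norm_coe_le_norm x)
  let Λ : C(UnitAddTorus (Fin d), ℂ) →ₗ[ℂ] ℂ :=
    { toFun := fun χ => ∫ x, χ x * h x ∂torusMeasure d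
      map_add' := fun χ₁ χ₂ => by
        rw [← integral_add (hint χ₁) (hint χ₂)]
        simp only [ContinuousMap.add_apply, add_mul]
      map_smul' := fun c χ => by
        rw [RingHom.id_apply, smul_eq_mul, ← integral_const_mul]
        simp only [ContinuousMap.smul_apply, smul_eq_mul, mul_assoc] }
  let Λc : C(UnitAddTorus (Fin d), ℂ) →L[ℂ] ℂ :=
    Λ.mkContinuous (∫ x, ‖h x‖ ∂torusMeasure d) fun χ => by
      refine (norm_integral_le_integral_norm _).trans ?_
      rw [mul_comm, ← integral_const_mul]
      refine integral_mono (hint χ).norm (hi.norm.const_mul _) fun x => ?_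
      simp only [norm_mul]
      gcongr
      exact χ.norm_coe_le_norm x
  have hle : (Submodule.span ℂ (Set.range (UnitAddTorus.mFourier (d := Fin d)))).topologicalClosure
      ≤ LinearMap.ker Λc.toLinearMap := by
    refine Submodule.topologicalClosure_minimal _ (Submodule.span_le.2 ?_) Λc.isClosed_ker
    rintro _ ⟨n, rfl⟩
    have := hz (-n)
    rw [mFourierCoeff_eq_integral_torusMeasure, neg_neg] at this
    exact this
  rw [UnitAddTorus.span_mFourier_closure_eq_top] at hle
  exact hle (Submodule.mem_top (x := χ))

/-- Uniqueness in weak form, enough to replace an arbitrary `g` by the hypersingular integral. -/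
theorem IsFracLaplacian.integral_mul_eq {g₁ g₂ ψ : UnitAddTorus (Fin d) → ℝ}
    (h₁ : IsFracLaplacian α f g₁) (h₂ : IsFracLaplacian α f g₂) (hψ : Continuous ψ) :
    ∫ x, g₁ x * ψ x ∂torusMeasure d = ∫ x, g₂ x * ψ x ∂torusMeasure d := by
  have hχ : Continuous fun x => (ψ x : ℂ) := by fun_prop
  have hb : ∀ χ : C(UnitAddTorus (Fin d), ℂ), ∀ g : UnitAddTorus (Fin d) → ℝ,
      Integrable g (torusMeasure d) → Integrable (fun x => χ x * (g x : ℂ)) (torusMeasure d) :=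
    fun χ g hg => hg.ofReal.bdd_mul χ.continuous.aestronglyMeasurable
      (Filter.Eventually.of_forall fun x => χ.norm_coe_le_norm x)
  have key := integral_mul_eq_zero_of_mFourierCoeff_eq_zero
    (h := fun x => (g₁ x : ℂ) - g₂ x) (h₁.1.ofReal.sub h₂.1.ofReal) (fun n => by
      rw [mFourierCoeff_eq_integral_torusMeasure]
      simp only [mul_sub]
      rw [integral_sub (hb _ _ h₁.1) (hb _ _ h₂.1)]
      exact sub_eq_zero.2 ((h₁.2 n).trans (h₂.2 n).symm)) ⟨_, hχ⟩
  simp only [mul_sub] at key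
  rw [integral_sub (hb ⟨_, hχ⟩ _ h₁.1) (hb ⟨_, hχ⟩ _ h₂.1), sub_eq_zero] at key
  simp only [ContinuousMap.coe_mk, ← Complex.ofReal_mul] at key
  rw [integral_complex_ofReal, integral_complex_ofReal] at key
  simpa only [mul_comm] using Complex.ofReal_injective key

/-- Joint integrability, which justifies the exchanges of the `x` and `y` integrals. -/
theorem IsC2Torus.integrable_secondDiff_mul_fracKernel (hf : IsC2Torus f) (hd : 1 ≤ d)
    (h0 : 0 < α) (h2 : α < 2) :
    Integrable (fun p : UnitAddTorus (Fin d) × EuclideanSpace ℝ (Fin d) =>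
      secondDiff f p.1 (toTorus p.2) * fracKernel α p.2) ((torusMeasure d).prod volume) := by
  have hc := hf.continuous
  obtain ⟨C, hC0, hC⟩ := hf.exists_abs_secondDiff_le
  obtain ⟨M, hM⟩ := isCompact_univ.exists_bound_of_continuousOn hc.continuousOn
  have hM' : ∀ x, |f x| ≤ M := fun x => hM x (Set.mem_univ x)
  have ht := continuous_toTorus (d := d)
  have hi : Integrable (fun p : UnitAddTorus (Fin d) × EuclideanSpace ℝ (Fin d) =>
      min (‖p.2‖ ^ 2) 1 * fracKernel α p.2) ((torusMeasure d).prod volume) :=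
    (integrable_min_mul_fracKernel hd h0 h2).comp_snd _
  refine (hi.const_mul (max C (4 * M))).mono' ?_ (Filter.Eventually.of_forall fun p =>
    abs_mul_fracKernel_le ?_ ?_)
  · have h3 : Continuous fun p : UnitAddTorus (Fin d) × EuclideanSpace ℝ (Fin d) =>
        secondDiff f p.1 (toTorus p.2) := by
      unfold secondDiff; fun_prop
    exact h3.aestronglyMeasurable.mul
      (measurable_fracKernel.comp measurable_snd).aestronglyMeasurable
  · exact (hC _ _).trans (by gcongr; exact le_max_left _ _)
  · refine le_trans ?_ (le_max_right _ _)
    have h4 := abs_le.1 (hM' p.1)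
    have h5 := abs_le.1 (hM' (p.1 + toTorus p.2))
    have h6 := abs_le.1 (hM' (p.1 - toTorus p.2))
    rw [secondDiff, abs_le]
    constructor <;> linarith

/-- The (unnormalised) fractional Laplacian as a hypersingular integral. -/
noncomputable def fracIntegral (α : ℝ) (f : UnitAddTorus (Fin d) → ℝ) (x : UnitAddTorus (Fin d)) :
    ℝ :=
  ∫ y : EuclideanSpace ℝ (Fin d), secondDiff f x (toTorus y) * fracKernel α y

theorem IsC2Torus.integrable_fracIntegral (hf : IsC2Torus f) (hd : 1 ≤ d)
    (h0 : 0 < α) (h2 : α < 2) : Integrable (fracIntegral α f) (torusMeasure d) :=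
  (hf.integrable_secondDiff_mul_fracKernel hd h0 h2).integral_prod_left

theorem IsC2Torus.integral_mul_fracIntegral (hf : IsC2Torus f) (hd : 1 ≤ d) (h0 : 0 < α)
    (h2 : α < 2) (χ : C(UnitAddTorus (Fin d), ℂ)) :
    ∫ x, χ x * (fracIntegral α f x : ℂ) ∂torusMeasure d
      = ∫ y : EuclideanSpace ℝ (Fin d),
          (∫ x, χ x * (secondDiff f x (toTorus y) : ℂ) ∂torusMeasure d) * (fracKernel α y : ℂ) := by
  have hi := hf.integrable_secondDiff_mul_fracKernel hd h0 h2
  have hi2 : Integrable (fun p : UnitAddTorus (Fin d) × EuclideanSpace ℝ (Fin d) =>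
      χ p.1 * ((secondDiff f p.1 (toTorus p.2) * fracKernel α p.2 : ℝ) : ℂ))
      ((torusMeasure d).prod volume) :=
    hi.ofReal.bdd_mul (χ.continuous.comp continuous_fst).aestronglyMeasurable
      (Filter.Eventually.of_forall fun p => χ.norm_coe_le_norm p.1)
  have := integral_integral_swap (f := fun (x : UnitAddTorus (Fin d))
    (y : EuclideanSpace ℝ (Fin d)) =>
      χ x * ((secondDiff f x (toTorus y) * fracKernel α y : ℝ) : ℂ)) hi2
  simp_rw [fracIntegral, ← integral_complex_ofReal, ← integral_const_mul]
  rw [this]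
  congr 1
  funext y
  rw [← integral_mul_const]
  congr 1
  funext x
  push_cast
  ring

theorem integral_mFourier_mul_secondDiff (hf : Continuous f) (n : Fin d → ℤ)
    (y : EuclideanSpace ℝ (Fin d)) :
    ∫ x, UnitAddTorus.mFourier (-n) x * (secondDiff f x (toTorus y) : ℂ) ∂torusMeasure d
      = (2 * (1 - cos (2 * π * ∑ i, n i * y i)) : ℝ)
        * UnitAddTorus.mFourierCoeff (fun x => (f x : ℂ)) n := by
  have h1 := mFourierCoeff_translate (fun x => (f x : ℂ)) n (toTorus y)
  have h2 := mFourierCoeff_translate (fun x => (f x : ℂ)) n (toTorus (-y))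
  rw [mFourierCoeff_eq_integral_torusMeasure, mFourier_toTorus] at h1 h2
  simp only [toTorus_neg, ← sub_eq_add_neg] at h2
  have e : ∀ x, UnitAddTorus.mFourier (-n) x * (secondDiff f x (toTorus y) : ℂ)
      = 2 * (UnitAddTorus.mFourier (-n) x * (f x : ℂ))
        - UnitAddTorus.mFourier (-n) x * (f (x + toTorus y) : ℂ)
        - UnitAddTorus.mFourier (-n) x * (f (x - toTorus y) : ℂ) := by
    intro x
    rw [secondDiff]
    push_cast
    ring
  simp_rw [e]
  rw [integral_sub (Continuous.integrable_torus (by fun_prop))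
      (Continuous.integrable_torus (by fun_prop)),
    integral_sub (Continuous.integrable_torus (by fun_prop))
      (Continuous.integrable_torus (by fun_prop)), integral_const_mul, h1, h2,
    ← mFourierCoeff_eq_integral_torusMeasure]
  have e2 : 2 * π * ∑ i, (n i : ℝ) * (-y) i = -(2 * π * ∑ i, (n i : ℝ) * y i) := by
    simp
  rw [e2]
  set θ := 2 * π * ∑ i, (n i : ℝ) * y i
  push_cast
  rw [Complex.cos]
  ring

/-- The multiplier at n is ∫ 2(1 - cos⟨ξ, y⟩)|y|^(-d-α) dy = 2A‖ξ‖^α with ξ = 2πn, hence the factor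
(2A)⁻¹. -/
theorem IsC2Torus.isFracLaplacian (hf : IsC2Torus f) (hd : 1 ≤ d) (h0 : 0 < α) (h2 : α < 2)
    {A : ℝ} (hA : 0 < A) (hs : ∀ ξ : EuclideanSpace ℝ (Fin d), fracSymbol α ξ = ‖ξ‖ ^ α * A) :
    IsFracLaplacian α f fun x => (2 * A)⁻¹ * fracIntegral α f x := by
  refine ⟨(hf.integrable_fracIntegral hd h0 h2).const_mul _, fun n => ?_⟩
  have hI := hf.integral_mul_fracIntegral hd h0 h2 (UnitAddTorus.mFourier (-n))
  simp_rw [integral_mFourier_mul_secondDiff hf.continuous n] at hI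
  set ξ : EuclideanSpace ℝ (Fin d) := WithLp.toLp 2 fun i => 2 * π * n i
  have hξ : ‖ξ‖ = 2 * π * √(∑ i, (n i : ℝ) ^ 2) := by
    rw [EuclideanSpace.norm_eq]
    simp only [ξ, Real.norm_eq_abs, sq_abs, mul_pow (2 * π)]
    rw [← Finset.mul_sum, Real.sqrt_mul (by positivity), Real.sqrt_sq (by positivity)]
  have hin : ∀ y, 2 * π * ∑ i, (n i : ℝ) * y i = inner ℝ ξ y := by
    intro y
    rw [PiLp.inner_apply, Finset.mul_sum]
    refine Finset.sum_congr rfl fun i _ => ?_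
    simp [ξ]
    ring
  set c := UnitAddTorus.mFourierCoeff (fun x => (f x : ℂ)) n
  have e : ∀ y : EuclideanSpace ℝ (Fin d),
      ((2 * (1 - cos (2 * π * ∑ i, (n i : ℝ) * y i)) : ℝ) : ℂ) * c * (fracKernel α y : ℂ)
      = (2 * c) * (((1 - cos (inner ℝ ξ y)) * fracKernel α y : ℝ) : ℂ) := by
    intro y
    rw [hin]
    push_cast
    ring
  simp_rw [e] at hI
  rw [integral_const_mul, integral_complex_ofReal, ← fracSymbol, hs, hξ] at hI
  have e2 : ∀ x, UnitAddTorus.mFourier (-n) x * (((2 * A)⁻¹ * fracIntegral α f x : ℝ) : ℂ)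
      = ((2 * A)⁻¹ : ℝ) * (UnitAddTorus.mFourier (-n) x * (fracIntegral α f x : ℂ)) := by
    intro x
    push_cast
    ring
  rw [mFourierCoeff_eq_integral_torusMeasure]
  simp_rw [e2]
  rw [integral_const_mul, hI]
  have hA' : (A : ℂ) ≠ 0 := by exact_mod_cast hA.ne'
  push_cast
  field_simp

/-- Nonnegativity of `I` allows everything outside one fundamental cube to be discarded; on the cube
the kernel is bounded below. -/
theorem IsC2Torus.integral_fracIntegral_mul_signedPow_ge (hf : IsC2Torus f) (hm : HasMeanZero f)
    (hd : 1 ≤ d) (h0 : 0 < α) (h2 : α < 2) {q : ℝ} (hq : 1 < q) :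
    2 * √d ^ (-(d + α)) * ∫ x, |f x| ^ q ∂torusMeasure d
      ≤ ∫ x, fracIntegral α f x * signedPow (q - 1) (f x) ∂torusMeasure d := by
  have hc := hf.continuous
  have hcψ : Continuous fun x => signedPow (q - 1) (f x) :=
    (continuous_signedPow (by linarith)).comp hf.continuous
  set ψ := fun x => signedPow (q - 1) (f x)
  have hχ : Continuous fun x => (ψ x : ℂ) := by fun_prop
  set I := fun t => ∫ x, secondDiff f x t * ψ x ∂torusMeasure d with hIdef
  have hI0 : ∀ t, 0 ≤ I t := fun t => by
    simp only [I]
    rw [integral_secondDiff_mul hc hcψ]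
    exact integral_nonneg fun x => sub_mul_signedPow_sub_nonneg hq _ _
  have hrepr : ∫ x, fracIntegral α f x * ψ x ∂torusMeasure d
      = ∫ y : EuclideanSpace ℝ (Fin d), I (toTorus y) * fracKernel α y := by
    have h := hf.integral_mul_fracIntegral hd h0 h2 ⟨_, hχ⟩
    simp only [ContinuousMap.coe_mk, ← Complex.ofReal_mul] at h
    simp_rw [integral_complex_ofReal, ← Complex.ofReal_mul] at h
    rw [integral_complex_ofReal] at h
    simpa only [mul_comm (ψ _)] using Complex.ofReal_injective h
  have hIint : Integrable (fun y : EuclideanSpace ℝ (Fin d) => I (toTorus y) * fracKernel α y) := by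
    obtain ⟨M, hM⟩ := isCompact_univ.exists_bound_of_continuousOn hcψ.continuousOn
    have h3 := ((hf.integrable_secondDiff_mul_fracKernel hd h0 h2).bdd_mul
      (hcψ.comp continuous_fst).aestronglyMeasurable
      (Filter.Eventually.of_forall fun p => hM p.1 (Set.mem_univ _))).integral_prod_right
    refine h3.congr (Filter.Eventually.of_forall fun y => ?_)
    simp only [I, Function.comp]
    rw [← integral_mul_const]
    congr 1
    funext x
    ring
  have hIT : Integrable I (torusMeasure d) := by
    have h4 : Integrable (Function.uncurry fun (t x : UnitAddTorus (Fin d)) =>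
        secondDiff f x t * ψ x) ((torusMeasure d).prod (torusMeasure d)) :=
      Continuous.integrable_of_hasCompactSupport
        (by unfold Function.uncurry secondDiff; fun_prop) (HasCompactSupport.of_compactSpace _)
    exact h4.integral_prod_left
  set Q : Set (EuclideanSpace ℝ (Fin d)) := {x | ∀ i, x i ∈ Set.Ioc (0:ℝ) 1}
  have hmp : MeasurePreserving (toTorus (d := d)) (volume.restrict Q) (torusMeasure d) :=
    measurePreserving_toTorus
  have hQ : MeasurableSet Q := by
    have : Q = ⋂ i, (fun x : EuclideanSpace ℝ (Fin d) => x i) ⁻¹' Set.Ioc (0:ℝ) 1 := by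
      ext x; simp [Q]
    rw [this]
    exact MeasurableSet.iInter fun i => measurableSet_Ioc.preimage
      (Continuous.measurable (by fun_prop))
  have hker : ∀ y ∈ Q, √d ^ (-(d + α)) ≤ fracKernel α y := by
    intro y hy
    -- The cube is open at 0, which excludes the origin, where the kernel has the default value 0.
    have hy0 : y ≠ 0 := by
      rintro rfl
      exact lt_irrefl _ (hy ⟨0, hd⟩).1
    refine Real.rpow_le_rpow_of_nonpos (norm_pos_iff.2 hy0) ?_ (by linarith [d.cast_nonneg (α := ℝ)])
    rw [EuclideanSpace.norm_eq]
    apply Real.sqrt_le_sqrt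
    calc _ ≤ ∑ _i : Fin d, (1:ℝ) := by
          gcongr with i
          rw [Real.norm_eq_abs, sq_abs]
          exact pow_le_one₀ (hy i).1.le (hy i).2
      _ = d := by simp
  have hcube : ∫ y in Q, I (toTorus y) = 2 * ∫ x, |f x| ^ q ∂torusMeasure d := by
    have h5 : ∫ t, I t ∂torusMeasure d = ∫ y in Q, I (toTorus y) := by
      rw [← hmp.map_eq]
      exact integral_map hmp.aemeasurable (hmp.map_eq.symm ▸ hIT.aestronglyMeasurable)
    rw [← h5, integral_integral_secondDiff_mul hc hcψ hm]
    simp only [ψ, mul_signedPow (show q - 1 + 1 ≠ 0 by linarith), sub_add_cancel]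
  rw [hrepr]
  calc _ = √d ^ (-(d + α)) * ∫ y in Q, I (toTorus y) := by rw [hcube]; ring
    _ = ∫ y in Q, √d ^ (-(d + α)) * I (toTorus y) := (integral_const_mul _ _).symm
    _ ≤ ∫ y in Q, I (toTorus y) * fracKernel α y := by
        refine setIntegral_mono_on ?_ hIint.integrableOn hQ fun y hy => ?_
        · exact (hmp.integrable_comp_of_integrable hIT).const_mul _
        · rw [mul_comm]
          exact mul_le_mul_of_nonneg_left (hker y hy) (hI0 _)
    _ ≤ _ := setIntegral_le_integral hIint (Filter.Eventually.of_forall fun y =>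
        mul_nonneg (hI0 _) (fracKernel_nonneg y))

end FracLaplacian

/-! ### Assembly of both inequalities. -/

theorem corollary1p4 :
    (∀ (d : ℕ) (_ : 1 ≤ d) (α : ℝ) (_ : 0 < α) (_ : α < 2),
      ∃ c₁ : ℝ, 0 < c₁ ∧
        ∀ f : UnitAddTorus (Fin d) → ℝ, IsC2Torus f → HasMeanZero f →
          (∃ g : UnitAddTorus (Fin d) → ℝ, IsFracLaplacian α f g) ∧
          ∀ g : UnitAddTorus (Fin d) → ℝ, IsFracLaplacian α f g →
            ∀ q : ℝ, 1 < q →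
              ∫ x, g x * (|f x| ^ (q - 2) * f x) ∂(torusMeasure d) ≥
                c₁ * ∫ x, |f x| ^ q ∂(torusMeasure d)) ∧
    (∃ c₂ : ℝ, 0 < c₂ ∧
      ∀ (d : ℕ) (_ : 1 ≤ d) (f : UnitAddTorus (Fin d) → ℝ), IsC2Torus f → HasMeanZero f →
        ∀ q : ℝ, 1 < q →
          -∫ x, torusLaplacian f x * (|f x| ^ (q - 2) * f x) ∂(torusMeasure d) ≥
            c₂ * ((q - 1) / q ^ 2) * ∫ x, |f x| ^ q ∂(torusMeasure d)) := by
  have hpow : ∀ q t : ℝ, |t| ^ (q - 2) * t = signedPow (q - 1) t := fun q t => by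
    rw [signedPow]
    congr 2
    ring
  constructor
  · intro d hd α h0 h2
    obtain ⟨A, hA, hs⟩ := exists_fracSymbol_eq hd h0 h2
    have hd0 : (0:ℝ) < d := by exact_mod_cast hd
    refine ⟨A⁻¹ * √d ^ (-(d + α)), by positivity, fun f hf hm => ?_⟩
    have hg := hf.isFracLaplacian hd h0 h2 hA hs
    refine ⟨⟨_, hg⟩, fun g hg' q hq => ?_⟩
    simp_rw [hpow]
    rw [hg'.integral_mul_eq hg (ψ := fun x => signedPow (q - 1) (f x))
      ((continuous_signedPow (by linarith)).comp hf.continuous)]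
    simp_rw [mul_assoc (2 * A)⁻¹]
    rw [integral_const_mul]
    have := mul_le_mul_of_nonneg_left (hf.integral_fracIntegral_mul_signedPow_ge hm hd h0 h2 hq)
      (show 0 ≤ (2 * A)⁻¹ by positivity)
    refine ge_iff_le.2 (le_of_eq_of_le ?_ this)
    field_simp
  · refine ⟨8 * π ^ 2, by positivity, fun d _ f hf hm q hq => ?_⟩
    simp_rw [hpow]
    exact hf.integral_laplacian_mul_signedPow_ge hm hq
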